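/- For $M\in\mathbb C^{n\times n}$ let $\mathrm{stril}(M)$ denote its strictly lower triangular part and $\|M\|_F$ its Frobenius norm. An orthogonalization procedure assigns to each pair $Q,W\in\mathbb C^{n\times n}$ a matrix $\mathcal O(Q,W)\in\mathbb C^{n\times n}$, regarded as the result of (approximately) orthogonalizing $Q(I+W)$. Assume that for all constants $c_Q,c_W$ there are constants $C'$ and $\varepsilon_0'>0$ such that for all $0<\varepsilon\le\varepsilon_0'$ and all $Q,W\in\mathbb C^{n\times n}$ with $W^H=-W$, $\|Q^HQ-I\|_F\le c_Q\varepsilon^2$ and $\|W\|_F\le c_W\varepsilon$, the matrix $Q'=\mathcal O(Q,W)$ satisfies $$\|Q'^HQ'-I\|_F\le C'\varepsilon^4,\qquad \|Q'-Q(I+W)\|_F\le C'\varepsilon^2 .$$ One refinement step applied to $A,Q$ is the following: set $E=\mathrm{stril}(Q^HAQ)$ and $T=Q^HAQ-E$, find a strictly lower triangular matrix $L$ with $\mathrm{stril}(E-LT+TL)=0$, and return $Q_{\mathsf{new}}=\mathcal O(Q,L-L^H)$. **Theorem.** Let $A\in\mathbb C^{n\times n}$ have pairwise distinct eigenvalues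 (that is, $n$ distinct eigenvalues), and let $\mathcal O$ be an orthogonalization procedure as above. Then there are constants $C$ and $\varepsilon_0>0$, depending only on $A$ and $\mathcal O$, such that for every $0<\varepsilon\le\varepsilon_0$ and every $Q\in\mathbb C^{n\times n}$ with $$\|\mathrm{stril}(Q^HAQ)\|_F\le\varepsilon,\qquad \|Q^HQ-I\|_F\le\varepsilon^2,$$ the equation for $L$ has exactly one strictly lower triangular solution, and the output $Q_{\mathsf{new}}$ of one refinement step applied to $A,Q$ satisfies $$\|\mathrm{stril}(Q_{\mathsf{new}}^HAQ_{\mathsf{new}})\|_F\le C\varepsilon^2,\qquad \|Q_{\mathsf{new}}^HQ_{\mathsf{new}}-I\|_F\le C\varepsilon^4 .$$ -/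

import Mathlib

-- Norms of matrices are Frobenius norms throughout.
open scoped Matrix Matrix.Norms.Frobenius

namespace SchurRefinement

/-- The strictly lower triangular part of a square matrix. -/
def stril {n : ℕ} (M : Matrix (Fin n) (Fin n) ℂ) : Matrix (Fin n) (Fin n) ℂ :=
  Matrix.of fun i j => if j < i then M i j else 0

/-- All entries on and above the diagonal vanish. -/
def IsStrictlyLower {n : ℕ} (L : Matrix (Fin n) (Fin n) ℂ) : Prop :=
  ∀ i j, i ≤ j → L i j = 0

/-- The eigenvalues, counted with algebraic multiplicity, are pairwise distinct. -/
def HasDistinctEigenvalues {n : ℕ} (A : Matrix (Fin n) (Fin n) ℂ) : Prop :=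
  A.charpoly.roots.Nodup

/-- `L` is a strictly lower triangular solution of the triangular matrix equation
`stril (E - L T + T L) = 0`, where `Qᴴ A Q = T + E` with `E = stril (Qᴴ A Q)`. -/
def IsCorrection {n : ℕ} (A Q L : Matrix (Fin n) (Fin n) ℂ) : Prop :=
  let E := stril (Qᴴ * A * Q)
  let T := Qᴴ * A * Q - E
  IsStrictlyLower L ∧ stril (E - L * T + T * L) = 0

/-- The requirement on an orthogonalization procedure: `orth Q W` is the matrix it returns when
it is applied to `Q (I + W)` (a procedure that sees only the product `Q (I + W)` is a special
case). Whatever the constants `cQ`, `cW`, if `W` is skew-Hermitian, `‖Qᴴ Q - I‖ ≤ cQ ε²` and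
`‖W‖ ≤ cW ε`, then the output `Qnew` satisfies `‖Qnewᴴ Qnew - I‖ = O(ε⁴)` and
`‖Qnew - Q (I + W)‖ = O(ε²)` as `ε → 0`, with constants that do not depend on `Q`, `W`, `ε`. -/
def IsOrthogonalization {n : ℕ}
    (orth : Matrix (Fin n) (Fin n) ℂ → Matrix (Fin n) (Fin n) ℂ → Matrix (Fin n) (Fin n) ℂ) :
    Prop :=
  ∀ cQ cW : ℝ, ∃ C : ℝ, ∃ ε₀ > 0, ∀ ε : ℝ, 0 < ε → ε ≤ ε₀ →
    ∀ Q W : Matrix (Fin n) (Fin n) ℂ, Wᴴ = -W →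
      ‖Qᴴ * Q - 1‖ ≤ cQ * ε ^ 2 → ‖W‖ ≤ cW * ε →
        ‖(orth Q W)ᴴ * orth Q W - 1‖ ≤ C * ε ^ 4 ∧
        ‖orth Q W - Q * (1 + W)‖ ≤ C * ε ^ 2

/-- `Qnew` is the output of one iteration of the refinement algorithm applied to `A`, `Q`:
split `Qᴴ A Q = T + E`, solve `stril (E - L T + T L) = 0` for a strictly lower triangular `L`,
and orthogonalize `Q (I + L - Lᴴ)`. -/
def IsRefinementStep {n : ℕ}
    (orth : Matrix (Fin n) (Fin n) ℂ → Matrix (Fin n) (Fin n) ℂ → Matrix (Fin n) (Fin n) ℂ)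
    (A Q Qnew : Matrix (Fin n) (Fin n) ℂ) : Prop :=
  ∃ L, IsCorrection A Q L ∧ Qnew = orth Q (L - Lᴴ)

end SchurRefinement

/-! Put `W = L - Lᴴ` and `Qnew = Q (1 + W) + R` with `R = O(ε²)`. As `W` is skew-Hermitian, `(1 +
W)ᴴ (T + E) (1 + W)` equals `T + (E - L T + T L) + (Lᴴ T - T Lᴴ)` up to terms with two factors among
`E`, `W`. The first and third summands are upper triangular and the equation for `L` kills `stril`
of the second, so only `O(ε²)` survives (`IsCorrection.stril_conj_eq`, `norm_stril_conj_le`).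

This needs `L = O(ε)` uniformly in `Q`. At an exact Schur form the diagonal of `T` consists of the
distinct eigenvalues of `A`, so `L ↦ stril (L T - T L)` is injective on strictly lower triangular
matrices. The unitary `Q` that triangularize `A` form a compact set, which gives a uniform lower
bound for this map near them (`exists_lower_bound_commutator`), hence also unique solvability. -/

namespace SchurRefinement

variable {n : ℕ}

/-! ### Projection onto the strictly lower triangular part -/

theorem stril_apply (M : Matrix (Fin n) (Fin n) ℂ) (i j : Fin n) :
    stril M i j = if j < i then M i j else 0 := rfl

/-- `stril` as a linear map. -/
def strilLin (n : ℕ) : Matrix (Fin n) (Fin n) ℂ →ₗ[ℂ] Matrix (Fin n) (Fin n) ℂ where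
  toFun := stril
  map_add' M N := by
    ext i j
    simp only [stril_apply, Matrix.add_apply]
    split_ifs <;> simp
  map_smul' c M := by
    ext i j
    simp only [stril_apply, Matrix.smul_apply, RingHom.id_apply]
    split_ifs <;> simp

theorem stril_add (M N : Matrix (Fin n) (Fin n) ℂ) : stril (M + N) = stril M + stril N :=
  map_add (strilLin n) M N

theorem stril_sub (M N : Matrix (Fin n) (Fin n) ℂ) : stril (M - N) = stril M - stril N :=
  map_sub (strilLin n) M N

theorem stril_smul (c : ℂ) (M : Matrix (Fin n) (Fin n) ℂ) : stril (c • M) = c • stril M :=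
  map_smul (strilLin n) c M

theorem continuous_stril : Continuous (stril : Matrix (Fin n) (Fin n) ℂ → _) :=
  (strilLin n).continuous_of_finiteDimensional

theorem isStrictlyLower_stril (M : Matrix (Fin n) (Fin n) ℂ) : IsStrictlyLower (stril M) :=
  fun _ _ hij => if_neg hij.not_gt

theorem IsStrictlyLower.stril_eq {L : Matrix (Fin n) (Fin n) ℂ} (hL : IsStrictlyLower L) :
    stril L = L := by
  ext i j
  rw [stril_apply]
  split_ifs with h
  · rfl
  · exact (hL i j (not_lt.1 h)).symm

theorem stril_stril (M : Matrix (Fin n) (Fin n) ℂ) : stril (stril M) = stril M :=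
  (isStrictlyLower_stril M).stril_eq

theorem stril_eq_zero_iff {M : Matrix (Fin n) (Fin n) ℂ} :
    stril M = 0 ↔ M.BlockTriangular id := by
  constructor
  · intro h i j hij
    simpa [stril_apply, show j < i from hij] using congrFun (congrFun h i) j
  · intro h
    ext i j
    rw [stril_apply]
    split_ifs with hij
    · exact h hij
    · rfl

theorem stril_sub_stril (M : Matrix (Fin n) (Fin n) ℂ) : stril (M - stril M) = 0 := by
  rw [stril_sub, stril_stril, sub_self]

theorem norm_stril_le (M : Matrix (Fin n) (Fin n) ℂ) : ‖stril M‖ ≤ ‖M‖ := by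
  rw [Matrix.frobenius_norm_def, Matrix.frobenius_norm_def]
  refine Real.rpow_le_rpow (by positivity) ?_ (by norm_num)
  gcongr with i _ j _
  rw [stril_apply]
  split_ifs <;> simp

theorem IsStrictlyLower.blockTriangular_conjTranspose {L : Matrix (Fin n) (Fin n) ℂ}
    (hL : IsStrictlyLower L) : Lᴴ.BlockTriangular id := by
  intro i j hij
  rw [Matrix.conjTranspose_apply, hL j i (le_of_lt hij), star_zero]

/-! ### Injectivity of the triangular operator at an exact Schur form -/

/-- For upper triangular `T` with distinct diagonal entries, the triangular matrix equation
is nonsingular. -/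
theorem IsStrictlyLower.eq_zero_of_stril_commutator {T L : Matrix (Fin n) (Fin n) ℂ}
    (hT : T.BlockTriangular id) (hinj : Function.Injective fun i => T i i)
    (hL : IsStrictlyLower L) (h : stril (L * T - T * L) = 0) : L = 0 := by
  -- Induction along diagonals, starting from the bottom left corner. Since `T` is upper triangular,
  -- entry `(i, j)` of the commutator involves, besides `L i j`, only `L i k` with `k < j` and `L k
  -- j` with `k > i`, where the measure `n - i + j` is smaller.
  have key : ∀ m : ℕ, ∀ i j : Fin n, n - (i : ℕ) + j = m → L i j = 0 := by
    intro m
    induction m using Nat.strong_induction_on with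
    | _ m ih =>
      intro i j hm
      by_cases hij : i ≤ j
      · exact hL i j hij
      rw [not_le] at hij
      have h0 := congrFun (congrFun h i) j
      rw [stril_apply, if_pos hij, Matrix.sub_apply, Matrix.mul_apply, Matrix.mul_apply,
        Finset.sum_eq_single j, Finset.sum_eq_single i] at h0
      · have hne : T j j - T i i ≠ 0 := sub_ne_zero.2 fun e => hij.ne (hinj e)
        refine (mul_eq_zero.1 (?_ : L i j * (T j j - T i i) = 0)).resolve_right hne
        rw [Matrix.zero_apply] at h0
        linear_combination h0
      · intro k _ hk
        rcases lt_or_gt_of_ne hk with hk | hk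
        · rw [hT hk, zero_mul]
        · rw [ih (n - (k : ℕ) + j) (by have := k.2; omega) k j rfl, mul_zero]
      · simp
      · intro k _ hk
        rcases lt_or_gt_of_ne hk with hk | hk
        · rw [ih (n - (i : ℕ) + k) (by omega) i k rfl, zero_mul]
        · rw [hT hk, mul_zero]
      · simp
  ext i j
  exact key _ i j rfl

/-- Unitary similarity preserves the characteristic polynomial, and the roots of that of a
triangular matrix are its diagonal entries with multiplicity. -/
theorem HasDistinctEigenvalues.diag_injective {A Q : Matrix (Fin n) (Fin n) ℂ}
    (hA : HasDistinctEigenvalues A) (hQ : Qᴴ * Q = 1)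
    (hT : (Qᴴ * A * Q).BlockTriangular id) :
    Function.Injective fun i => (Qᴴ * A * Q) i i := by
  have hc : (Qᴴ * A * Q).charpoly = A.charpoly := by
    rw [mul_assoc, Matrix.charpoly_mul_comm, mul_assoc, mul_eq_one_comm.1 hQ, mul_one]
  have hA' : (Qᴴ * A * Q).charpoly.roots.Nodup := by rw [hc]; exact hA
  rw [Matrix.charpoly_of_isUpperTriangular _ hT, Polynomial.roots_prod _ _
    (Finset.prod_ne_zero_iff.2 fun i _ => Polynomial.X_sub_C_ne_zero _)] at hA'
  simp only [Polynomial.roots_X_sub_C, Multiset.bind_singleton] at hA'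
  intro i j hij
  exact Multiset.inj_on_of_nodup_map hA' i (Finset.mem_univ i) j (Finset.mem_univ j) hij

theorem norm_entry_le (M : Matrix (Fin n) (Fin n) ℂ) (i j : Fin n) : ‖M i j‖ ≤ ‖M‖ := by
  rw [Matrix.frobenius_norm_def, ← Real.sqrt_eq_rpow]
  refine Real.le_sqrt_of_sq_le ?_
  calc ‖M i j‖ ^ 2 ≤ ∑ b, ‖M i b‖ ^ 2 :=
        Finset.single_le_sum (f := fun b => ‖M i b‖ ^ 2) (fun _ _ => by positivity)
          (Finset.mem_univ j)
    _ ≤ ∑ a, ∑ b, ‖M a b‖ ^ 2 :=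
        Finset.single_le_sum (f := fun a => ∑ b, ‖M a b‖ ^ 2) (fun _ _ => by positivity)
          (Finset.mem_univ i)
    _ = _ := by norm_cast

/-- The diagonal of `Qᴴ Q` holds the squared column norms, each of which is therefore at most 2. -/
theorem norm_le_of_norm_conjTranspose_mul_self_sub_one_le {Q : Matrix (Fin n) (Fin n) ℂ}
    (hQ : ‖Qᴴ * Q - 1‖ ≤ 1) : ‖Q‖ ≤ √(2 * n) := by
  rw [Matrix.frobenius_norm_def, ← Real.sqrt_eq_rpow, Finset.sum_comm]
  refine Real.sqrt_le_sqrt ?_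
  have hcol : ∀ j : Fin n, ∑ i, ‖Q i j‖ ^ (2 : ℝ) ≤ 2 := by
    intro j
    have h1 : (Qᴴ * Q) j j = ((∑ i, ‖Q i j‖ ^ (2 : ℝ) : ℝ) : ℂ) := by
      rw [Matrix.mul_apply]
      push_cast
      refine Finset.sum_congr rfl fun i _ => ?_
      rw [Matrix.conjTranspose_apply, RCLike.star_def, Complex.conj_mul']
      norm_cast
    have h2 := (norm_entry_le (Qᴴ * Q - 1) j j).trans hQ
    rw [Matrix.sub_apply, h1, Matrix.one_apply_eq, ← Complex.ofReal_one, ← Complex.ofReal_sub,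
      Complex.norm_real, Real.norm_eq_abs] at h2
    linarith [(abs_le.1 h2).2]
  calc ∑ j, ∑ i, ‖Q i j‖ ^ (2 : ℝ) ≤ ∑ _j : Fin n, (2 : ℝ) := Finset.sum_le_sum fun j _ => hcol j
    _ = 2 * n := by simp [mul_comm]

/-! ### Uniform lower bound by compactness -/

/-- The upper triangular part of `Qᴴ A Q`. -/
def upperPart (A Q : Matrix (Fin n) (Fin n) ℂ) : Matrix (Fin n) (Fin n) ℂ :=
  Qᴴ * A * Q - stril (Qᴴ * A * Q)

theorem continuous_conj (A : Matrix (Fin n) (Fin n) ℂ) :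
    Continuous fun Q : Matrix (Fin n) (Fin n) ℂ => Qᴴ * A * Q :=
  (continuous_star.mul continuous_const).mul continuous_id

theorem continuous_upperPart (A : Matrix (Fin n) (Fin n) ℂ) : Continuous (upperPart A) :=
  (continuous_conj A).sub (continuous_stril.comp (continuous_conj A))

theorem continuous_stril_commutator (A : Matrix (Fin n) (Fin n) ℂ) :
    Continuous fun p : Matrix (Fin n) (Fin n) ℂ × Matrix (Fin n) (Fin n) ℂ =>
      stril (p.2 * upperPart A p.1 - upperPart A p.1 * p.2) := by
  have hT := (continuous_upperPart A).comp
    (continuous_fst (X := Matrix (Fin n) (Fin n) ℂ) (Y := Matrix (Fin n) (Fin n) ℂ))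
  exact continuous_stril.comp ((continuous_snd.mul hT).sub (hT.mul continuous_snd))

open Filter Topology in
/-- Near the unitary matrices that triangularize `A`, the operator of the triangular matrix
equation is bounded below uniformly. -/
theorem exists_lower_bound_commutator {A : Matrix (Fin n) (Fin n) ℂ}
    (hA : HasDistinctEigenvalues A) :
    ∃ c > 0, ∃ δ > 0, δ ≤ 1 ∧ ∀ Q : Matrix (Fin n) (Fin n) ℂ,
      ‖stril (Qᴴ * A * Q)‖ ≤ δ → ‖Qᴴ * Q - 1‖ ≤ δ → ∀ L, IsStrictlyLower L →
        c * ‖L‖ ≤ ‖stril (L * upperPart A Q - upperPart A Q * L)‖ := by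
  by_contra! hcon
  have hpos : ∀ k : ℕ, (0 : ℝ) < 1 / ((k : ℝ) + 1) := fun k => by positivity
  have hle : ∀ k : ℕ, 1 / ((k : ℝ) + 1) ≤ 1 := fun k => by
    rw [div_le_one (by positivity)]
    linarith [Nat.cast_nonneg (α := ℝ) k]
  -- Failure of the bound for `c = δ = 1 / (k + 1)` gives pairs `(Q, L)`, with `L` scaled to norm 1.
  -- A limit point has `Q` unitary, `Qᴴ A Q` upper triangular and `L` of norm 1 in the kernel,
  -- against injectivity.
  have hseq : ∀ k : ℕ, ∃ p : Matrix (Fin n) (Fin n) ℂ × Matrix (Fin n) (Fin n) ℂ,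
      ‖stril (p.1ᴴ * A * p.1)‖ ≤ 1 / ((k : ℝ) + 1) ∧ ‖p.1ᴴ * p.1 - 1‖ ≤ 1 / ((k : ℝ) + 1) ∧
      stril p.2 = p.2 ∧ ‖p.2‖ = 1 ∧
      ‖stril (p.2 * upperPart A p.1 - upperPart A p.1 * p.2)‖ ≤ 1 / ((k : ℝ) + 1) := by
    intro k
    obtain ⟨Q, h1, h2, L, hL, h3⟩ := hcon _ (hpos k) _ (hpos k) (hle k)
    have hL0 : 0 < ‖L‖ := by
      refine norm_pos_iff.2 fun h => ?_
      refine h3.not_ge ?_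
      rw [h, norm_zero, mul_zero]
      exact norm_nonneg _
    have hr : ‖((‖L‖⁻¹ : ℝ) : ℂ)‖ = ‖L‖⁻¹ := by
      rw [Complex.norm_real, norm_inv, norm_norm]
    refine ⟨(Q, ((‖L‖⁻¹ : ℝ) : ℂ) • L), h1, h2, ?_, ?_, ?_⟩
    · rw [stril_smul, hL.stril_eq]
    · rw [norm_smul, hr, inv_mul_cancel₀ hL0.ne']
    · rw [Matrix.smul_mul, Matrix.mul_smul, ← smul_sub, stril_smul, norm_smul, hr,
        inv_mul_le_iff₀ hL0, mul_comm]
      exact h3.le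
  choose p h1 h2 h3 h4 h5 using hseq
  have : ProperSpace (Matrix (Fin n) (Fin n) ℂ) := FiniteDimensional.proper ℂ _
  obtain ⟨⟨Q, L⟩, -, φ, hφ, hlim⟩ := ((isCompact_closedBall (0 : Matrix (Fin n) (Fin n) ℂ)
    √(2 * n)).prod (isCompact_closedBall (0 : Matrix (Fin n) (Fin n) ℂ) 1)).tendsto_subseq
    (x := p) fun k => ⟨mem_closedBall_zero_iff.2
      (norm_le_of_norm_conjTranspose_mul_self_sub_one_le ((h2 k).trans (hle k))),
      mem_closedBall_zero_iff.2 (h4 k).le⟩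
  have hzero : Tendsto (fun k => 1 / ((φ k : ℝ) + 1)) atTop (𝓝 0) :=
    tendsto_one_div_add_atTop_nhds_zero_nat.comp hφ.tendsto_atTop
  have hQlim : Tendsto (fun k => (p (φ k)).1) atTop (𝓝 Q) :=
    (continuous_fst.tendsto _).comp hlim
  have hLlim : Tendsto (fun k => (p (φ k)).2) atTop (𝓝 L) :=
    (continuous_snd.tendsto _).comp hlim
  have e1 : stril (Qᴴ * A * Q) = 0 := tendsto_nhds_unique
    (((continuous_stril.comp (continuous_conj A)).tendsto Q).comp hQlim)
    (squeeze_zero_norm (fun k => h1 (φ k)) hzero)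
  have e2 : Qᴴ * Q - 1 = 0 := tendsto_nhds_unique
    ((((continuous_star.mul continuous_id).sub continuous_const).tendsto Q).comp hQlim)
    (squeeze_zero_norm (fun k => h2 (φ k)) hzero)
  have e3 : stril L = L := tendsto_nhds_unique ((continuous_stril.tendsto L).comp hLlim)
    (hLlim.congr fun k => (h3 (φ k)).symm)
  have e4 : ‖L‖ = 1 := tendsto_nhds_unique hLlim.norm
    (tendsto_const_nhds.congr fun k => (h4 (φ k)).symm)
  have e5 : stril (L * upperPart A Q - upperPart A Q * L) = 0 := tendsto_nhds_unique
    (((continuous_stril_commutator A).tendsto (Q, L)).comp hlim)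
    (squeeze_zero_norm (fun k => h5 (φ k)) hzero)
  rw [upperPart, e1, sub_zero] at e5
  have hT := stril_eq_zero_iff.1 e1
  have hL0 := (e3 ▸ isStrictlyLower_stril L).eq_zero_of_stril_commutator hT
    (hA.diag_injective (sub_eq_zero.1 e2) hT) e5
  rw [hL0, norm_zero] at e4
  exact zero_ne_one e4

/-! ### Unique solvability of the correction equation -/

theorem isCorrection_iff {A Q L : Matrix (Fin n) (Fin n) ℂ} :
    IsCorrection A Q L ↔ IsStrictlyLower L ∧
      stril (L * upperPart A Q - upperPart A Q * L) = stril (Qᴴ * A * Q) := by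
  rw [IsCorrection]
  refine and_congr_right fun _ => ?_
  change stril (_ - L * upperPart A Q + upperPart A Q * L) = 0 ↔ _
  rw [sub_add, stril_sub, stril_stril, sub_eq_zero, eq_comm]

/-- The triangular matrix equation `stril (L T - T L) = E` is uniquely solvable as soon as its
homogeneous version is. -/
theorem existsUnique_stril_commutator_eq {T E : Matrix (Fin n) (Fin n) ℂ}
    (hT : ∀ L, IsStrictlyLower L → stril (L * T - T * L) = 0 → L = 0)
    (hE : IsStrictlyLower E) :
    ∃! L, IsStrictlyLower L ∧ stril (L * T - T * L) = E := by
  let S := strilLin n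
  -- The operator is extended by the identity on upper triangular matrices. This makes it an
  -- endomorphism of a finite-dimensional space, so injectivity implies surjectivity.
  let Φ : Matrix (Fin n) (Fin n) ℂ →ₗ[ℂ] Matrix (Fin n) (Fin n) ℂ :=
    S ∘ₗ (LinearMap.mulRight ℂ T - LinearMap.mulLeft ℂ T) ∘ₗ S + (LinearMap.id - S)
  have hΦ : ∀ M, Φ M = stril (stril M * T - T * stril M) + (M - stril M) := fun _ => rfl
  have hstril : ∀ M, stril (Φ M) = stril (stril M * T - T * stril M) := fun M => by
    rw [hΦ, stril_add, stril_stril, stril_sub_stril, add_zero]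
  have hinj : Function.Injective Φ := by
    rw [← LinearMap.ker_eq_bot, LinearMap.ker_eq_bot']
    intro M hM
    have h1 : stril (stril M * T - T * stril M) = 0 := by
      rw [← hstril, hM]
      exact map_zero (strilLin n)
    have h2 := hT _ (isStrictlyLower_stril M) h1
    rwa [hΦ, h1, h2, sub_zero, zero_add] at hM
  obtain ⟨M, hM⟩ := LinearMap.injective_iff_surjective.1 hinj E
  refine ⟨stril M, ⟨isStrictlyLower_stril M, ?_⟩, ?_⟩
  · rw [← hstril, hM, hE.stril_eq]
  · rintro L ⟨hL, hLE⟩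
    have : L = M := hinj (by rw [hM, hΦ, hL.stril_eq, sub_self, add_zero, hLE])
    rw [← this, hL.stril_eq]

/-! ### Expansion and second-order estimate -/

/-- The first-order terms of `stril (Qnewᴴ A Qnew)` cancel. -/
theorem IsCorrection.stril_conj_eq {A Q L R : Matrix (Fin n) (Fin n) ℂ}
    (h : IsCorrection A Q L) :
    stril ((Q * (1 + (L - Lᴴ)) + R)ᴴ * A * (Q * (1 + (L - Lᴴ)) + R)) =
      stril (stril (Qᴴ * A * Q) * (L - Lᴴ) - (L - Lᴴ) * stril (Qᴴ * A * Q)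
        - (L - Lᴴ) * (Qᴴ * A * Q) * (L - Lᴴ)
        + (Q * (1 + (L - Lᴴ)))ᴴ * A * R + Rᴴ * A * (Q * (1 + (L - Lᴴ)) + R)) := by
  obtain ⟨hL, h⟩ := isCorrection_iff.1 h
  have hT : stril (upperPart A Q) = 0 := stril_sub_stril _
  have hTb := stril_eq_zero_iff.1 hT
  have hLb := hL.blockTriangular_conjTranspose
  have hU : stril (upperPart A Q * Lᴴ - Lᴴ * upperPart A Q) = 0 :=
    stril_eq_zero_iff.2 ((hTb.mul hLb).sub (hLb.mul hTb))
  -- These are exactly the terms of the expansion that the right-hand side omits; subtracting them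
  -- leaves a noncommutative ring identity inside `stril`.
  have hzero : stril (upperPart A Q + (stril (Qᴴ * A * Q)
      - (L * upperPart A Q - upperPart A Q * L))
      - (upperPart A Q * Lᴴ - Lᴴ * upperPart A Q)) = 0 := by
    rw [stril_sub, stril_add, stril_sub, hT, hU, h, stril_stril]
    simp
  rw [← sub_eq_zero, ← stril_sub, ← hzero]
  congr 1
  simp only [upperPart, Matrix.conjTranspose_add, Matrix.conjTranspose_mul,
    Matrix.conjTranspose_sub, Matrix.conjTranspose_one, Matrix.conjTranspose_conjTranspose]
  noncomm_ring

/-- Each remaining term has either two factors among `E`, `W`, both `O(ε)`, or a factor `R = O(ε²)`;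
the other factors are bounded because `ε ≤ 1`. -/
theorem norm_stril_conj_le {A Q L Q' : Matrix (Fin n) (Fin n) ℂ} {q w r ε : ℝ}
    (h : IsCorrection A Q L) (hε : 0 < ε) (hε1 : ε ≤ 1)
    (hE : ‖stril (Qᴴ * A * Q)‖ ≤ ε) (hQ : ‖Q‖ ≤ q) (hW : ‖L - Lᴴ‖ ≤ w * ε)
    (hR : ‖Q' - Q * (1 + (L - Lᴴ))‖ ≤ r * ε ^ 2) :
    ‖stril (Q'ᴴ * A * Q')‖ ≤
      (2 * w + w ^ 2 * (q ^ 2 * ‖A‖)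
        + (2 * (q * (‖(1 : Matrix (Fin n) (Fin n) ℂ)‖ + w)) + r) * ‖A‖ * r) * ε ^ 2 := by
  have hw : 0 ≤ w := nonneg_of_mul_nonneg_left ((norm_nonneg _).trans hW) hε
  have hr : 0 ≤ r := nonneg_of_mul_nonneg_left ((norm_nonneg _).trans hR) (by positivity)
  have hq : 0 ≤ q := (norm_nonneg _).trans hQ
  have hform := h.stril_conj_eq (R := Q' - Q * (1 + (L - Lᴴ)))
  rw [add_sub_cancel] at hform
  rw [hform]
  refine (norm_stril_le _).trans ?_
  set W := L - Lᴴ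
  set X := Q * (1 + W) with hX
  set R := Q' - X with hRdef
  set E := stril (Qᴴ * A * Q)
  set B := Qᴴ * A * Q with hB
  set o := ‖(1 : Matrix (Fin n) (Fin n) ℂ)‖
  have hBn : ‖B‖ ≤ q ^ 2 * ‖A‖ := by
    calc ‖B‖ ≤ ‖Qᴴ‖ * ‖A‖ * ‖Q‖ := norm_mul₃_le
      _ = ‖Q‖ * ‖A‖ * ‖Q‖ := by rw [Matrix.frobenius_norm_conjTranspose]
      _ ≤ q * ‖A‖ * q := by gcongr
      _ = _ := by ring
  have hXn : ‖X‖ ≤ q * (o + w) := by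
    calc ‖X‖ ≤ ‖Q‖ * ‖1 + W‖ := norm_mul_le _ _
      _ ≤ q * (o + w) := by
        gcongr
        refine (norm_add_le _ _).trans ?_
        gcongr
        exact hW.trans (mul_le_of_le_one_right hw hε1)
  have hQ' : ‖Q'‖ ≤ q * (o + w) + r := by
    calc ‖Q'‖ = ‖X + R‖ := by rw [hRdef, add_sub_cancel]
      _ ≤ ‖X‖ + ‖R‖ := norm_add_le _ _
      _ ≤ _ := by
        gcongr
        exact hR.trans (mul_le_of_le_one_right hr (pow_le_one₀ hε.le hε1))
  have b1 : ‖E * W‖ ≤ ε * (w * ε) := (norm_mul_le _ _).trans (by gcongr)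
  have b2 : ‖W * E‖ ≤ w * ε * ε := (norm_mul_le _ _).trans (by gcongr)
  have b3 : ‖W * B * W‖ ≤ w * ε * (q ^ 2 * ‖A‖) * (w * ε) := norm_mul₃_le.trans (by gcongr)
  have b4 : ‖Xᴴ * A * R‖ ≤ q * (o + w) * ‖A‖ * (r * ε ^ 2) := by
    refine norm_mul₃_le.trans ?_
    rw [Matrix.frobenius_norm_conjTranspose]
    gcongr
  have b5 : ‖Rᴴ * A * Q'‖ ≤ r * ε ^ 2 * ‖A‖ * (q * (o + w) + r) := by
    refine norm_mul₃_le.trans ?_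
    rw [Matrix.frobenius_norm_conjTranspose]
    gcongr
  calc _ ≤ ‖E * W‖ + ‖W * E‖ + ‖W * B * W‖ + ‖Xᴴ * A * R‖ + ‖Rᴴ * A * Q'‖ := by
        refine (norm_add_le _ _).trans ?_
        gcongr
        refine (norm_add_le _ _).trans ?_
        gcongr
        refine (norm_sub_le _ _).trans ?_
        gcongr
        exact norm_sub_le _ _
    _ ≤ ε * (w * ε) + w * ε * ε + w * ε * (q ^ 2 * ‖A‖) * (w * ε)
          + q * (o + w) * ‖A‖ * (r * ε ^ 2) + r * ε ^ 2 * ‖A‖ * (q * (o + w) + r) := by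
        gcongr
    _ = _ := by ring

end SchurRefinement

theorem theorem2p3 {n : ℕ}
    (orth : Matrix (Fin n) (Fin n) ℂ → Matrix (Fin n) (Fin n) ℂ → Matrix (Fin n) (Fin n) ℂ)
    (h_orth : SchurRefinement.IsOrthogonalization orth)
    (A : Matrix (Fin n) (Fin n) ℂ) (hA : SchurRefinement.HasDistinctEigenvalues A) :
    ∃ C : ℝ, ∃ ε₀ > 0, ∀ ε : ℝ, 0 < ε → ε ≤ ε₀ →
      ∀ Q : Matrix (Fin n) (Fin n) ℂ,
        ‖SchurRefinement.stril (Qᴴ * A * Q)‖ ≤ ε → ‖Qᴴ * Q - 1‖ ≤ ε ^ 2 →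
          (∃! L, SchurRefinement.IsCorrection A Q L) ∧
          ∀ Qnew, SchurRefinement.IsRefinementStep orth A Q Qnew →
            ‖SchurRefinement.stril (Qnewᴴ * A * Qnew)‖ ≤ C * ε ^ 2 ∧
            ‖Qnewᴴ * Qnew - 1‖ ≤ C * ε ^ 4 := by
  obtain ⟨c, hc, δ, hδ, hδ1, hbound⟩ := SchurRefinement.exists_lower_bound_commutator hA
  -- The lower bound will give `‖L‖ ≤ ε / c`, hence `‖L - Lᴴ‖ ≤ (2 / c) ε`.
  obtain ⟨r, ε₁, hε₁, horth⟩ := h_orth 1 (2 / c)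
  refine ⟨max r (2 * (2 / c) + (2 / c) ^ 2 * (√(2 * n) ^ 2 * ‖A‖)
      + (2 * (√(2 * n) * (‖(1 : Matrix (Fin n) (Fin n) ℂ)‖ + 2 / c)) + r) * ‖A‖ * r),
    min ε₁ δ, lt_min hε₁ hδ, fun ε hε hε₀ Q hE hQ => ?_⟩
  have hεδ : ε ≤ δ := hε₀.trans (min_le_right _ _)
  have hε1 : ε ≤ 1 := hεδ.trans hδ1
  -- The lower bound asks for the same `δ` in both hypotheses, so the defect `ε²` of orthogonality
  -- is weakened to `ε`.
  have hsq : ε ^ 2 ≤ ε := by nlinarith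
  have hlow := hbound Q (hE.trans hεδ) (hQ.trans (hsq.trans hεδ))
  constructor
  · simp only [SchurRefinement.isCorrection_iff]
    refine SchurRefinement.existsUnique_stril_commutator_eq (fun L hL h => ?_)
      (SchurRefinement.isStrictlyLower_stril _)
    have := hlow L hL
    rw [h, norm_zero] at this
    exact norm_le_zero_iff.1 (nonpos_of_mul_nonpos_right this hc)
  · rintro Qnew ⟨L, hL, rfl⟩
    have hL' := SchurRefinement.isCorrection_iff.1 hL
    have hLn : ‖L‖ ≤ ε / c := by
      rw [le_div_iff₀' hc]
      refine (hlow L hL'.1).trans ?_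
      rwa [hL'.2]
    have hW : ‖L - Lᴴ‖ ≤ 2 / c * ε := by
      calc ‖L - Lᴴ‖ ≤ ‖L‖ + ‖Lᴴ‖ := norm_sub_le _ _
        _ = ‖L‖ + ‖L‖ := by rw [Matrix.frobenius_norm_conjTranspose]
        _ ≤ ε / c + ε / c := by gcongr
        _ = _ := by ring
    obtain ⟨h1, h2⟩ := horth ε hε (hε₀.trans (min_le_left _ _)) Q (L - Lᴴ)
      (by rw [Matrix.conjTranspose_sub, Matrix.conjTranspose_conjTranspose, neg_sub])
      (by rwa [one_mul]) hW
    have hQn :=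
      SchurRefinement.norm_le_of_norm_conjTranspose_mul_self_sub_one_le (hQ.trans (hsq.trans hε1))
    refine ⟨(SchurRefinement.norm_stril_conj_le hL hε hε1 hE hQn hW h2).trans
      (mul_le_mul_of_nonneg_right (le_max_right _ _) (by positivity)), h1.trans ?_⟩
    exact mul_le_mul_of_nonneg_right (le_max_left _ _) (by positivity)
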